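/- Let $(R,\mathfrak m)$ be a Noetherian local ring with residue field $k=R/\mathfrak m$ and let $I\subseteq R$ be an ideal. For a finitely generated $R$-module $M$ write $\beta_i^R(M)=\dim_k \operatorname{Tor}_i^R(M,k)$ for its $i$-th Betti number. The Hilbert function of an ideal $J\subseteq R$ is $$\mathrm{HF}_{R/J}(n)=\dim_k\bigl(\mathfrak m^n(R/J)/\mathfrak m^{n+1}(R/J)\bigr),\qquad n\ge 0,$$ and $J\equiv I \bmod \mathfrak m^N$ means $J+\mathfrak m^N=I+\mathfrak m^N$. 1. For every integer $p\ge 0$ there exists an integer $N>0$ such that, for every ideal $J\subseteq R$ with $J\equiv I\bmod \mathfrak m^N$ and $\mathrm{HF}_{R/J}=\mathrm{HF}_{R/I}$, one has $\beta_i^R(R/I)=\beta_i^R(R/J)$ for all $0\le i\le p$. 2. There exists an integer $N_0$ such that for every $N\ge N_0$ and every ideal $J\subseteq R$ with $J\equiv I\bmod \mathfrak m^N$ and $\mathrm{HF}_{R/J}=\mathrm{HF}_{R/I}$, the $R$-modules $R/I$ and $R/J$ have the same projective dimension (possibly infinite). -/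

import Mathlib

universe u

open CategoryTheory IsLocalRing

noncomputable section

namespace BettiPerturbation

variable (R : Type u) [CommRing R]

/-- The `R`-module `Tor_i^R(M, N)`: the homology in degree `i` of `P ⊗ N`, where `P` is a
projective resolution of `M`. -/
abbrev TorModule (M N : Type u) [AddCommGroup M] [Module R M] [AddCommGroup N] [Module R N]
    (i : ℕ) : ModuleCat.{u} R :=
  ((Tor' (ModuleCat.{u} R) i).obj (ModuleCat.of R M)).obj (ModuleCat.of R N)

/-- If `a` annihilates `N`, then `a` annihilates `Tor_i^R(M, N)`. -/
theorem smul_tor_eq_zero (M N : Type u) [AddCommGroup M] [Module R M]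
    [AddCommGroup N] [Module R N] (a : R) (ha : ∀ y : N, a • y = 0) (i : ℕ)
    (x : TorModule R M N i) : a • x = 0 := by
  let F := (MonoidalCategory.tensoringRight (ModuleCat.{u} R)).obj (ModuleCat.of R N)
  let P := projectiveResolution (ModuleCat.of R M)
  let K := (F.mapHomologicalComplex _).obj P.complex
  have hK (j : ℕ) : a • 𝟙 (K.X j) = 0 := by
    ext z
    change a • (show TensorProduct R (P.complex.X j) N from z) = 0
    induction z using TensorProduct.induction_on with
    | zero => exact smul_zero a
    | tmul y n => rw [← TensorProduct.tmul_smul, ha, TensorProduct.tmul_zero]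
    | add y z hy hz => exact (smul_add a _ _).trans (by rw [hy, hz, add_zero])
  have hc : a • 𝟙 (K.cycles i) = 0 := by
    rw [← cancel_mono (K.iCycles i), Linear.smul_comp, Category.id_comp, Limits.zero_comp,
      ← Category.comp_id (K.iCycles i), ← Linear.comp_smul, hK, Limits.comp_zero]
  have hh : a • 𝟙 (K.homology i) = 0 := by
    rw [← cancel_epi (K.homologyπ i), Linear.comp_smul, Category.comp_id, Limits.comp_zero,
      ← Category.id_comp (K.homologyπ i), ← Linear.smul_comp, hc, Limits.zero_comp]
  let e := P.isoLeftDerivedObj F i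
  have hT : a • 𝟙 ((F.leftDerived i).obj (ModuleCat.of R M)) = 0 := by
    rw [← cancel_mono e.hom, Linear.smul_comp, Category.id_comp, Limits.zero_comp,
      ← Category.comp_id e.hom, ← Linear.comp_smul]
    exact (congrArg (e.hom ≫ ·) hh).trans Limits.comp_zero
  exact congrArg (fun f => f.hom x) hT

variable [IsLocalRing R]

/-- The `k`-vector space structure on `Tor_i^R(M, k)`, where `k` is the residue field of the local
ring `R`: it is the one that induces the given `R`-module structure. -/
instance torResidueFieldModule (M : Type u) [AddCommGroup M] [Module R M] (i : ℕ) :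
    Module (ResidueField R) (TorModule R M (ResidueField R) i) :=
  Module.IsTorsionBySet.module (I := maximalIdeal R) fun x a =>
    smul_tor_eq_zero R M (ResidueField R) a
      (fun y => by
        rw [Algebra.smul_def, ResidueField.algebraMap_eq, (residue_eq_zero_iff _).2 a.2,
          zero_mul]) i x

/-- The `i`-th Betti number `β_i^R(M) = dim_k Tor_i^R(M, k)` of a finitely generated module `M`
over a Noetherian local ring `R` with residue field `k`. -/
def bettiNumber (M : Type u) [AddCommGroup M] [Module R M] (i : ℕ) : ℕ :=
  Module.finrank (ResidueField R) (TorModule R M (ResidueField R) i)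

/-- The degree `n` component `𝔪ⁿM / 𝔪ⁿ⁺¹M` of the associated graded module `gr_𝔪(M)`. -/
abbrev GradedPiece (M : Type u) [AddCommGroup M] [Module R M] (n : ℕ) : Type u :=
  (maximalIdeal R ^ n • ⊤ : Submodule R M) ⧸
    (maximalIdeal R • ⊤ : Submodule R (maximalIdeal R ^ n • ⊤ : Submodule R M))

instance gradedPieceModule (M : Type u) [AddCommGroup M] [Module R M] (n : ℕ) :
    Module (ResidueField R) (GradedPiece R M n) :=
  inferInstanceAs (Module (R ⧸ maximalIdeal R) (GradedPiece R M n))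

variable {R}

/-- The Hilbert function of an ideal `I` of a Noetherian local ring `(R, 𝔪, k)`, that is, the
Hilbert function `n ↦ dim_k (𝔪ⁿ(R/I) / 𝔪ⁿ⁺¹(R/I))` of `R/I`. -/
def hilbertFunction (I : Ideal R) (n : ℕ) : ℕ :=
  Module.finrank (ResidueField R) (GradedPiece R (R ⧸ I) n)

/-- `I ≡ J mod 𝔪^N`, that is, `I + 𝔪^N = J + 𝔪^N`. -/
def CongrModPow (I J : Ideal R) (N : ℕ) : Prop :=
  I ⊔ maximalIdeal R ^ N = J ⊔ maximalIdeal R ^ N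

/-- The projective dimension of `R/I` as an `R`-module: `⊤` if it is infinite, `⊥` if `R/I = 0`. -/
def projDimQuotient (I : Ideal R) : WithBot ℕ∞ :=
  projectiveDimension (ModuleCat.of R (R ⧸ I))

end BettiPerturbation

end

/-! Let `d` be an Artin-Rees bound for `I`. If `J ≡ I` modulo `𝔪^N`, elements of `I` of order `n`
lie in `𝔪^(n-d) I`, hence agree with elements of `J` up to order `n + N - d`
(`IsArtinReesBound.adicClose`). So initial forms of `I` are initial forms of `J`, and equal Hilbert
functions make this inclusion an equality. Then `d` is an Artin-Rees bound for `J` too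
(`IsArtinReesBound.transfer`), so the approximation holds in both directions with a gain uniform in
`J`.

Two-sided closeness passes to syzygies: moving the images of a basis in a minimal cover of `L` into
`L'` gives a minimal cover of `L'` whose kernel is close to the old one, with a loss depending only
on `L` (`exists_perturbation`). Minimal covers shift Betti numbers by one, so iterating `p` times
proves the first part.

For the second part, `pd M < n` iff `β_n(M) = 0`, and the finite projective dimensions over `R` are
bounded (`exists_bound_projectiveDimension`), so finitely many Betti numbers determine the
projective dimension. -/

noncomputable section

namespace BettiPerturbation

/-! ### Artin-Rees bounds and adic approximation of submodules -/

section AdicApproximation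

variable {R : Type u} [CommRing R] {E F : Type*} [AddCommGroup E] [Module R E]
  [AddCommGroup F] [Module R F]

/-- `d` is an Artin-Rees bound for `L ≤ E`: every element of `L` of `𝔞`-adic order at least `n`
lies in `𝔞ⁿ⁻ᵈ L`. -/
def IsArtinReesBound (𝔞 : Ideal R) (d : ℕ) (L : Submodule R E) : Prop :=
  ∀ n, L ⊓ 𝔞 ^ n • ⊤ ≤ 𝔞 ^ (n - d) • L

/-- `L` is `𝔞`-adically approximated by `L'` with a gain of `c`: elements of `L` of order at least
`n` agree with elements of `L'` up to order `n + c`. -/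
def AdicClose (𝔞 : Ideal R) (c : ℕ) (L L' : Submodule R E) : Prop :=
  ∀ n, L ⊓ 𝔞 ^ n • ⊤ ≤ L' ⊔ 𝔞 ^ (n + c) • ⊤

variable {𝔞 : Ideal R} {c d : ℕ} {L L' : Submodule R E}

lemma pow_smul_top_anti {m n : ℕ} (h : m ≤ n) :
    (𝔞 ^ n • ⊤ : Submodule R E) ≤ 𝔞 ^ m • ⊤ :=
  Submodule.smul_mono_left (Ideal.pow_le_pow_right h)

lemma exists_isArtinReesBound [IsNoetherianRing R] [Module.Finite R E] (𝔞 : Ideal R)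
    (L : Submodule R E) : ∃ d, IsArtinReesBound 𝔞 d L := by
  obtain ⟨d, hd⟩ := 𝔞.exists_pow_inf_eq_pow_smul L
  refine ⟨d, fun n => ?_⟩
  rcases le_total n d with h | h
  · rw [Nat.sub_eq_zero_of_le h, pow_zero, one_smul]
    exact inf_le_left
  · rw [inf_comm, hd n h]
    exact smul_mono_right _ inf_le_right

lemma AdicClose.mono {c' : ℕ} (h : AdicClose 𝔞 c' L L') (hc : c ≤ c') : AdicClose 𝔞 c L L' :=
  fun n => (h n).trans (sup_le_sup_left (pow_smul_top_anti (by omega)) _)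

lemma AdicClose.le (h : AdicClose 𝔞 c L L') : L ≤ L' ⊔ 𝔞 ^ c • ⊤ := by
  simpa using h 0

/-- An Artin-Rees bound for `L` turns a congruence `L ⊆ L' + 𝔞ᴺE` into an approximation. -/
lemma IsArtinReesBound.adicClose (hL : IsArtinReesBound 𝔞 d L) {N : ℕ} (hN : d ≤ N)
    (h : L ≤ L' ⊔ 𝔞 ^ N • ⊤) : AdicClose 𝔞 (N - d) L L' := by
  intro n
  refine (hL n).trans ((smul_mono_right _ h).trans ?_)
  rw [Submodule.smul_sup, ← Submodule.mul_smul, ← pow_add]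
  exact sup_le_sup Submodule.smul_le_right (pow_smul_top_anti (by omega))

/-- **Krull's intersection theorem** for a submodule. -/
lemma mem_of_forall_mem_sup_pow_smul [IsLocalRing R] [IsNoetherianRing R] [Module.Finite R E]
    {x : E} (h : ∀ n, x ∈ L ⊔ maximalIdeal R ^ n • ⊤) : x ∈ L := by
  rw [← Submodule.Quotient.mk_eq_zero, ← Submodule.mem_bot R,
    ← Ideal.iInf_pow_smul_eq_bot_of_isLocalRing (M := E ⧸ L) (maximalIdeal R)
      (maximalIdeal.isMaximal R).ne_top, Submodule.mem_iInf]
  intro n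
  have := Submodule.mem_map_of_mem (f := L.mkQ) (h n)
  rw [Submodule.map_sup, Submodule.mkQ_map_self, bot_sup_eq, Submodule.map_smul'',
    Submodule.map_top, Submodule.range_mkQ] at this
  exact this

/-- An Artin-Rees bound is inherited by any submodule with the same initial forms which is
sufficiently close. -/
lemma IsArtinReesBound.transfer [IsLocalRing R] [IsNoetherianRing R] [Module.Finite R E]
    (hL : IsArtinReesBound (maximalIdeal R) d L)
    (h : L ≤ L' ⊔ maximalIdeal R ^ (d + 1) • ⊤) (h' : AdicClose (maximalIdeal R) 1 L' L) :
    IsArtinReesBound (maximalIdeal R) d L' := by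
  -- One order is gained because `(n - d) + (d + 1) ≥ n + 1`, also for `n < d` with truncated
  -- subtraction.
  have step (n : ℕ) : L' ⊓ maximalIdeal R ^ n • ⊤ ≤
      maximalIdeal R ^ (n - d) • L' ⊔ maximalIdeal R ^ (n + 1) • ⊤ := by
    rintro x ⟨hx, hxn⟩
    obtain ⟨l, hl, e, he, rfl⟩ := Submodule.mem_sup.1 (h' n ⟨hx, hxn⟩)
    have hln : l ∈ (maximalIdeal R ^ n • ⊤ : Submodule R E) := by
      simpa using sub_mem hxn (pow_smul_top_anti n.le_succ he)
    have := smul_mono_right (maximalIdeal R ^ (n - d)) h (hL n ⟨hl, hln⟩)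
    rw [Submodule.smul_sup, ← Submodule.mul_smul, ← pow_add] at this
    exact add_mem (SetLike.le_def.1 (sup_le_sup_left (pow_smul_top_anti (by omega)) _) this)
      (Submodule.mem_sup_right he)
  -- The error term lies in `L'` again, so `step` can be repeated; Krull's theorem then removes the
  -- error.
  have iter (n k : ℕ) : L' ⊓ maximalIdeal R ^ n • ⊤ ≤
      maximalIdeal R ^ (n - d) • L' ⊔ maximalIdeal R ^ (n + k) • ⊤ := by
    induction k with
    | zero => exact inf_le_right.trans le_sup_right
    | succ k ih =>
      intro x hx
      obtain ⟨y, hy, z, hz, rfl⟩ := Submodule.mem_sup.1 (ih hx)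
      have hzL : z ∈ L' := by simpa using sub_mem hx.1 (Submodule.smul_le_right hy)
      exact add_mem (Submodule.mem_sup_left hy) (SetLike.le_def.1 (sup_le_sup_right
        (Submodule.smul_mono_left (Ideal.pow_le_pow_right
          (Nat.sub_le_sub_right (Nat.le_add_right n k) d))) _) (step _ ⟨hzL, hz⟩))
  intro n x hx
  exact mem_of_forall_mem_sup_pow_smul fun k =>
    SetLike.le_def.1 (sup_le_sup_left (pow_smul_top_anti (by omega)) _) (iter n k hx)

/-- If two maps agree modulo `𝔞ᶜ` then the kernel of the first is approximated by the kernel of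
the second, with a loss given by an Artin-Rees bound for the image of the second. -/
lemma adicClose_ker {φ ψ : F →ₗ[R] E} (hψ : IsArtinReesBound 𝔞 d (LinearMap.range ψ))
    (h : ∀ x, φ x - ψ x ∈ (𝔞 ^ c • ⊤ : Submodule R E)) (hc : d ≤ c) :
    AdicClose 𝔞 (c - d) (LinearMap.ker φ) (LinearMap.ker ψ) := by
  rintro n x ⟨hx, hxn⟩
  have hmap : (𝔞 ^ n • ⊤ : Submodule R F).map (φ - ψ) ≤ 𝔞 ^ (n + c) • ⊤ := by
    rw [Submodule.map_smul'', pow_add, Submodule.mul_smul]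
    refine smul_mono_right _ ?_
    rintro _ ⟨y, -, rfl⟩
    exact h y
  have hψx : ψ x ∈ (𝔞 ^ (n + c) • ⊤ : Submodule R E) := by
    have := hmap ⟨x, hxn, rfl⟩
    rw [LinearMap.sub_apply, LinearMap.mem_ker.1 hx, zero_sub] at this
    simpa using this
  -- Artin-Rees writes `ψ x = ψ y` with `y` of order `n + c - d`; then `x - y` is the required
  -- element of `ker ψ`.
  have := hψ _ ⟨⟨x, rfl⟩, hψx⟩
  rw [LinearMap.range_eq_map, ← Submodule.map_smul''] at this
  obtain ⟨y, hy, hyx⟩ := this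
  refine Submodule.mem_sup.2 ⟨x - y, ?_, y, pow_smul_top_anti (by omega) hy, by simp⟩
  rw [LinearMap.mem_ker, map_sub, hyx, sub_self]

/-- A presentation of `L` can be perturbed to a presentation of any sufficiently close `L'`, such
that the kernels remain close. -/
theorem exists_perturbation [IsLocalRing R] [IsNoetherianRing R] [Module.Finite R E]
    [Module.Free R F] (φ : F →ₗ[R] E)
    (hφ : IsArtinReesBound (maximalIdeal R) d (LinearMap.range φ))
    (h : AdicClose (maximalIdeal R) (c + d + 1) (LinearMap.range φ) L')
    (h' : AdicClose (maximalIdeal R) (c + d + 1) L' (LinearMap.range φ)) :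
    ∃ ψ : F →ₗ[R] E, LinearMap.range ψ = L' ∧
      AdicClose (maximalIdeal R) (c + 1) (LinearMap.ker φ) (LinearMap.ker ψ) ∧
      AdicClose (maximalIdeal R) (c + 1) (LinearMap.ker ψ) (LinearMap.ker φ) := by
  have hL' : IsArtinReesBound (maximalIdeal R) d L' :=
    hφ.transfer (h.mono (by omega)).le (h'.mono (by omega))
  let b := Module.Free.chooseBasis R F
  have key (i) : ∃ y ∈ L', φ (b i) - y ∈ (maximalIdeal R ^ (c + d + 1) • ⊤ : Submodule R E) := by
    obtain ⟨y, hy, z, hz, hyz⟩ := Submodule.mem_sup.1 (h.le ⟨b i, rfl⟩)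
    exact ⟨y, hy, by simpa [← hyz] using hz⟩
  choose g hg hgφ using key
  let ψ : F →ₗ[R] E := b.constr ℕ g
  have hle : LinearMap.range ψ ≤ L' := by
    rw [Module.Basis.constr_range, Submodule.span_le]
    rintro _ ⟨i, rfl⟩
    exact hg i
  have hψ (x) : φ x - ψ x ∈ (maximalIdeal R ^ (c + d + 1) • ⊤ : Submodule R E) := by
    have hr : LinearMap.range (φ - ψ) ≤ maximalIdeal R ^ (c + d + 1) • ⊤ := by
      rw [LinearMap.range_eq_map, ← b.span_eq, Submodule.map_span, Submodule.span_le]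
      rintro _ ⟨_, ⟨i, rfl⟩, rfl⟩
      simpa [ψ] using hgφ i
    exact hr ⟨x, rfl⟩
  -- Nakayama: an element of `L'` differs from some `ψ y` by an element of `L'` of order `c + d +
  -- 1`, which lies in `𝔪^(c+1) L'` by the transferred bound.
  have hrange : LinearMap.range ψ = L' := by
    refine le_antisymm hle ?_
    refine Submodule.le_of_le_smul_of_le_jacobson_bot (I := maximalIdeal R)
      (IsNoetherian.noetherian L') (maximalIdeal_le_jacobson _) ?_
    intro x hx
    obtain ⟨_, ⟨y, rfl⟩, z, hz, rfl⟩ := Submodule.mem_sup.1 (h'.le hx)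
    have hzy : ψ y - (φ y + z) ∈ (maximalIdeal R ^ (c + d + 1) • ⊤ : Submodule R E) := by
      have := neg_mem (add_mem (hψ y) hz)
      convert this using 1
      abel
    have hm := hL' _ ⟨sub_mem (hle ⟨y, rfl⟩) hx, hzy⟩
    have hm' : φ y + z - ψ y ∈ maximalIdeal R • L' := by
      rw [← neg_sub]
      refine neg_mem (Submodule.smul_mono_left ?_ hm)
      exact (Ideal.pow_le_pow_right (by omega)).trans (pow_one _).le
    exact Submodule.mem_sup.2 ⟨ψ y, ⟨y, rfl⟩, _, hm', by abel⟩
  refine ⟨ψ, hrange, ?_, ?_⟩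
  · exact (adicClose_ker (hrange ▸ hL') hψ (by omega)).mono (by omega)
  · refine (adicClose_ker hφ (fun x => ?_) (c := c + d + 1) (by omega)).mono (by omega)
    rw [← neg_sub]
    exact neg_mem (hψ x)

end AdicApproximation

/-! ### Splicing projective resolutions and dimension shifting -/

section Splice

open Limits

variable {C : Type*} [Category* C] [Abelian C]

/-- The augmentation `P₀ ⟶ Z` of a projective resolution of `Z`. -/
def augmentation {Z : C} (P : ProjectiveResolution Z) : P.complex.X 0 ⟶ Z :=
  (ChainComplex.toSingle₀Equiv P.complex Z P.π).1

lemma d_comp_augmentation {Z : C} (P : ProjectiveResolution Z) :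
    P.complex.d 1 0 ≫ augmentation P = 0 :=
  (ChainComplex.toSingle₀Equiv P.complex Z P.π).2

lemma augmentation_exact {Z : C} (P : ProjectiveResolution Z) :
    (ShortComplex.mk _ _ (d_comp_augmentation P)).Exact := by
  exact P.exact₀

instance {Z : C} (P : ProjectiveResolution Z) : Epi (augmentation P) := by
  exact inferInstanceAs (Epi (P.π.f 0))

variable {S : ShortComplex C}

/-- A projective resolution of `S.X₁` extended by `S.X₂` in degree zero. -/
def spliceComplex (P : ProjectiveResolution S.X₁) : ChainComplex C ℕ :=
  P.complex.augment (augmentation P ≫ S.f)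
    (by rw [← Category.assoc, d_comp_augmentation, zero_comp])

lemma d_comp_augmentation_comp {Y : C} {Z : C} (P : ProjectiveResolution Z) (f : Z ⟶ Y) :
    P.complex.d 1 0 ≫ augmentation P ≫ f = 0 := by
  rw [← Category.assoc, d_comp_augmentation, zero_comp]

lemma spliceComplex_exactAt_succ (hS : S.ShortExact) (P : ProjectiveResolution S.X₁) (n : ℕ) :
    (spliceComplex P).ExactAt (n + 1) := by
  rw [HomologicalComplex.exactAt_iff' _ (n + 1 + 1) (n + 1) n (by simp) (by simp)]
  cases n with
  | zero =>
    have := hS.mono_f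
    refine (ShortComplex.exact_iff_of_epi_of_isIso_of_mono
      (S₁ := ShortComplex.mk _ _ (d_comp_augmentation P))
      (S₂ := ShortComplex.mk _ _ (d_comp_augmentation_comp P S.f))
      { τ₁ := 𝟙 _, τ₂ := 𝟙 _, τ₃ := S.f, comm₁₂ := ?_, comm₂₃ := ?_ }).1 (augmentation_exact P)
    · exact (Category.id_comp _).trans (Category.comp_id _).symm
    · exact (Category.id_comp _)
  | succ n => exact P.exact_succ n

lemma spliceComplex_d_comp (P : ProjectiveResolution S.X₁) :
    (spliceComplex P).d 1 0 ≫ (S.g : (spliceComplex P).X 0 ⟶ S.X₃) = 0 := by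
  change (augmentation P ≫ S.f) ≫ S.g = 0
  rw [Category.assoc, S.zero, comp_zero]

/-- The projective resolution of `S.X₃` obtained from one of `S.X₁` if `S` is short exact with
`S.X₂` projective. -/
def splice (hS : S.ShortExact) [Projective S.X₂] (P : ProjectiveResolution S.X₁) :
    ProjectiveResolution S.X₃ where
  complex := spliceComplex P
  projective n := by
    cases n with
    | zero => exact inferInstanceAs (Projective S.X₂)
    | succ n => exact P.projective n
  π := (ChainComplex.toSingle₀Equiv (spliceComplex P) S.X₃).symm ⟨S.g, spliceComplex_d_comp P⟩
  quasiIso := ⟨fun n => by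
    cases n with
    | zero =>
      rw [ChainComplex.quasiIsoAt₀_iff, ShortComplex.quasiIso_iff_of_zeros']
      · refine (ShortComplex.exact_and_epi_g_iff_of_iso
          (S₂ := ShortComplex.mk (augmentation P ≫ S.f) S.g
            (by rw [Category.assoc, S.zero, comp_zero])) ?_).2 ⟨?_, ?_⟩
        · refine ShortComplex.isoMk (Iso.refl _) (Iso.refl _) (Iso.refl _) ?_ ?_
          · exact (Category.id_comp _).trans (Category.comp_id _).symm
          · refine (Category.id_comp _).trans (Eq.trans ?_ (Category.comp_id _).symm)
            exact (ChainComplex.toSingle₀Equiv_symm_apply_f_zero (C := spliceComplex P) (X := S.X₃)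
              S.g (spliceComplex_d_comp P)).symm
        · refine (ShortComplex.exact_iff_of_epi_of_isIso_of_mono
            (S₁ := ShortComplex.mk (augmentation P ≫ S.f) S.g
              (by rw [Category.assoc, S.zero, comp_zero])) (S₂ := S)
            { τ₁ := augmentation P, τ₂ := 𝟙 _, τ₃ := 𝟙 _, comm₁₂ := ?_, comm₂₃ := ?_ }).2 hS.exact
          · exact (Category.comp_id _).symm
          · exact (Category.id_comp _).trans (Category.comp_id _).symm
        · exact hS.epi_g
      all_goals rfl
    | succ n =>
      rw [quasiIsoAt_iff_exactAt']
      · exact spliceComplex_exactAt_succ hS P n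
      · apply ChainComplex.exactAt_succ_single_obj⟩

lemma nonempty_homology_iso_cokernel (T : ShortComplex C) (hg : T.g = 0) :
    Nonempty (T.homology ≅ cokernel T.f) :=
  ⟨(ShortComplex.LeftHomologyData.ofIsColimitCokernelCofork T hg _
    (cokernelIsCokernel T.f)).homologyIso⟩

lemma nonempty_homology_iso_X₂ (T : ShortComplex C) (hf : T.f = 0) (hg : T.g = 0) :
    Nonempty (T.homology ≅ T.X₂) :=
  ⟨(ShortComplex.LeftHomologyData.ofZeros T hf hg).homologyIso⟩

variable [HasProjectiveResolutions C] {D : Type*} [Category* D] [Abelian D] (F : C ⥤ D) [F.Additive]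

/-- Left derived functors as the homology of three consecutive terms of a complex. -/
def leftDerivedIsoHomologySc' {Z : C} (P : ProjectiveResolution Z) (i j k : ℕ)
    (hi : (ComplexShape.down ℕ).prev j = i) (hk : (ComplexShape.down ℕ).next j = k) :
    (F.leftDerived j).obj Z ≅
      (((F.mapHomologicalComplex _).obj P.complex).sc' i j k).homology :=
  P.isoLeftDerivedObj F j ≪≫
    ShortComplex.homologyMapIso (HomologicalComplex.isoSc' _ i j k hi hk)

/-- Dimension shifting for left derived functors. -/
theorem nonempty_leftDerived_iso_succ (hS : S.ShortExact) [Projective S.X₂] (n : ℕ) :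
    Nonempty ((F.leftDerived (n + 2)).obj S.X₃ ≅ (F.leftDerived (n + 1)).obj S.X₁) := by
  let P := projectiveResolution S.X₁
  -- The two three-term windows agree definitionally, since splicing only shifts degrees.
  let e : (((F.mapHomologicalComplex _).obj (splice hS P).complex).sc' (n + 3) (n + 2)
      (n + 1)).homology ≅
      (((F.mapHomologicalComplex _).obj P.complex).sc' (n + 2) (n + 1) n).homology := Iso.refl _
  exact ⟨leftDerivedIsoHomologySc' F (splice hS P) (n + 3) (n + 2) (n + 1) (by simp) (by simp) ≪≫
    e ≪≫ (leftDerivedIsoHomologySc' F P (n + 2) (n + 1) n (by simp) (by simp)).symm⟩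

/-- As `F` kills `S.f`, the last differential of the spliced complex vanishes after `F`, so both
sides are the cokernel of `F(P₁) ⟶ F(P₀)`. -/
theorem nonempty_leftDerived_one_iso (hS : S.ShortExact) [Projective S.X₂]
    (hF : F.map S.f = 0) :
    Nonempty ((F.leftDerived 1).obj S.X₃ ≅ (F.leftDerived 0).obj S.X₁) := by
  let P := projectiveResolution S.X₁
  obtain ⟨e₁⟩ := nonempty_homology_iso_cokernel
    (((F.mapHomologicalComplex _).obj (splice hS P).complex).sc' 2 1 0) (by
      change F.map (augmentation P ≫ S.f) = 0
      rw [F.map_comp, hF, comp_zero])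
  obtain ⟨e₂⟩ := nonempty_homology_iso_cokernel
    -- In `ComplexShape.down ℕ` the successor of `0` defaults to `0`, and `d 0 0 = 0`.
    (((F.mapHomologicalComplex _).obj P.complex).sc' 1 0 0) (by
      change F.map (P.complex.d 0 0) = 0
      rw [P.complex.shape _ _ (by simp), F.map_zero])
  exact ⟨leftDerivedIsoHomologySc' F (splice hS P) 2 1 0 (by simp) (by simp) ≪≫ e₁ ≪≫
    e₂.symm ≪≫ (leftDerivedIsoHomologySc' F P 1 0 0 (by simp) (by simp)).symm⟩

theorem nonempty_leftDerived_zero_iso (hS : S.ShortExact) [Projective S.X₂]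
    (hF : F.map S.f = 0) :
    Nonempty ((F.leftDerived 0).obj S.X₃ ≅ F.obj S.X₂) := by
  let P := projectiveResolution S.X₁
  obtain ⟨e⟩ := nonempty_homology_iso_X₂
    (((F.mapHomologicalComplex _).obj (splice hS P).complex).sc' 1 0 0) (by
      change F.map (augmentation P ≫ S.f) = 0
      rw [F.map_comp, hF, comp_zero]) (by
      change F.map ((splice hS P).complex.d 0 0) = 0
      rw [(splice hS P).complex.shape _ _ (by simp), F.map_zero])
  exact ⟨leftDerivedIsoHomologySc' F (splice hS P) 1 0 0 (by simp) (by simp) ≪≫ e⟩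

end Splice

/-! ### Betti numbers through minimal covers -/

section Betti

open scoped TensorProduct

variable {R : Type u} [CommRing R] [IsLocalRing R]
  {F M : Type u} [AddCommGroup F] [Module R F] [AddCommGroup M] [Module R M]

instance (M : Type u) [AddCommGroup M] [Module R M] (i : ℕ) :
    IsScalarTower R (ResidueField R) (TorModule R M (ResidueField R) i) := by
  exact Module.IsTorsionBySet.isScalarTower (I := maximalIdeal R) _

lemma finrank_residueField_eq_of_linearEquiv {V W : Type*} [AddCommGroup V] [AddCommGroup W]
    [Module R V] [Module R W] [Module (ResidueField R) V] [Module (ResidueField R) W]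
    [IsScalarTower R (ResidueField R) V] [IsScalarTower R (ResidueField R) W] (e : V ≃ₗ[R] W) :
    Module.finrank (ResidueField R) V = Module.finrank (ResidueField R) W :=
  (e.extendScalarsOfSurjective (residue_surjective (R := R))).finrank_eq

lemma bettiNumber_eq_of_linearEquiv {N : Type u} [AddCommGroup N] [Module R N] {i j : ℕ}
    (e : TorModule R M (ResidueField R) i ≃ₗ[R] TorModule R N (ResidueField R) j) :
    bettiNumber R M i = bettiNumber R N j :=
  finrank_residueField_eq_of_linearEquiv e

/-- `φ : F → M` is a minimal cover: it is surjective with kernel contained in `𝔪F`. -/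
structure IsMinimalCover (φ : F →ₗ[R] M) : Prop where
  surjective : Function.Surjective φ
  ker_le : LinearMap.ker φ ≤ maximalIdeal R • ⊤

lemma IsMinimalCover.tensor_eq_zero {φ : F →ₗ[R] M} (hφ : IsMinimalCover φ) :
    ((MonoidalCategory.tensoringRight (ModuleCat.{u} R)).obj
      (ModuleCat.of R (ResidueField R))).map φ.shortComplexKer.f = 0 := by
  ext z
  change LinearMap.rTensor (ResidueField R) (LinearMap.ker φ).subtype z = 0
  induction z using TensorProduct.induction_on with
  | zero => exact map_zero _
  | tmul y a =>
    rw [LinearMap.rTensor_tmul]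
    have hy : (LinearMap.ker φ).subtype y ∈ (maximalIdeal R • ⊤ : Submodule R F) :=
      hφ.ker_le y.2
    refine Submodule.smul_induction_on (p := fun x => x ⊗ₜ[R] a = 0) hy ?_ ?_
    · intro r hr x _
      rw [TensorProduct.smul_tmul, Algebra.smul_def, ResidueField.algebraMap_eq,
        (residue_eq_zero_iff _).2 hr, zero_mul, TensorProduct.tmul_zero]
    · intro x y hx hy
      rw [TensorProduct.add_tmul, hx, hy, add_zero]
  | add y z hy hz => rw [map_add, hy, hz, add_zero]

/-- Minimality matters only for `i = 0`, where it kills `ker φ ⊗ k → F ⊗ k`; for `i > 0` this is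
ordinary dimension shifting. -/
theorem IsMinimalCover.bettiNumber_succ [Module.Free R F] {φ : F →ₗ[R] M}
    (hφ : IsMinimalCover φ) (i : ℕ) :
    bettiNumber R M (i + 1) = bettiNumber R (LinearMap.ker φ) i := by
  have hS := LinearMap.shortExact_shortComplexKer hφ.surjective
  have : Projective φ.shortComplexKer.X₂ := inferInstanceAs (Projective (ModuleCat.of R F))
  cases i with
  | zero =>
    obtain ⟨e⟩ := nonempty_leftDerived_one_iso _ hS hφ.tensor_eq_zero
    exact bettiNumber_eq_of_linearEquiv e.toLinearEquiv
  | succ i =>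
    obtain ⟨e⟩ := nonempty_leftDerived_iso_succ
      ((MonoidalCategory.tensoringRight (ModuleCat.{u} R)).obj
        (ModuleCat.of R (ResidueField R))) hS i
    exact bettiNumber_eq_of_linearEquiv e.toLinearEquiv

theorem IsMinimalCover.bettiNumber_zero [Module.Free R F] {φ : F →ₗ[R] M}
    (hφ : IsMinimalCover φ) : bettiNumber R M 0 = Module.finrank R F := by
  have hS := LinearMap.shortExact_shortComplexKer hφ.surjective
  have : Projective φ.shortComplexKer.X₂ := inferInstanceAs (Projective (ModuleCat.of R F))
  obtain ⟨e⟩ := nonempty_leftDerived_zero_iso _ hS hφ.tensor_eq_zero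
  let e' : TorModule R M (ResidueField R) 0 ≃ₗ[R] TensorProduct R F (ResidueField R) :=
    e.toLinearEquiv
  rw [bettiNumber, finrank_residueField_eq_of_linearEquiv
    (e'.trans (TensorProduct.comm R F (ResidueField R))), Module.finrank_baseChange]

end Betti

/-! ### Minimal covers and projective dimension -/

section MinimalCover

variable {R : Type u} [CommRing R] [IsLocalRing R]
  {F M : Type u} [AddCommGroup F] [Module R F] [AddCommGroup M] [Module R M]

open scoped TensorProduct

/-- Every finitely generated module over a local ring has a minimal cover. -/
theorem exists_isMinimalCover (R : Type u) [CommRing R] [IsLocalRing R] (M : Type u)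
    [AddCommGroup M] [Module R M] [Module.Finite R M] :
    ∃ (n : ℕ) (φ : (Fin n → R) →ₗ[R] M), IsMinimalCover φ := by
  let b := Module.finBasis (ResidueField R) (ResidueField R ⊗[R] M)
  obtain ⟨v, hv⟩ := (TensorProduct.mk_surjective R M (ResidueField R)
    (residue_surjective (R := R))).comp_left b
  refine ⟨_, Fintype.linearCombination R v, ?_, fun a ha => ?_⟩
  · rw [← LinearMap.range_eq_top, Fintype.range_linearCombination]
    exact span_eq_top_of_tmul_eq_basis v b (congr_fun hv)
  -- Reducing a relation modulo `𝔪` gives a relation among basis vectors, so its coefficients lie in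
  -- `𝔪`.
  · have h0 : ∑ i, residue R (a i) • b i = 0 := by
      have := congrArg (TensorProduct.mk R (ResidueField R) M 1) (LinearMap.mem_ker.1 ha)
      rw [Fintype.linearCombination_apply, map_sum, map_zero] at this
      rw [← this]
      refine Finset.sum_congr rfl fun i _ => ?_
      rw [map_smul, ← congr_fun hv i]
      exact algebraMap_smul (ResidueField R) (a i) _
    have h1 := Fintype.linearIndependent_iff.1 b.linearIndependent _ h0
    rw [pi_eq_sum_univ' a]
    refine sum_mem fun i _ => Submodule.smul_mem_smul ?_ trivial
    exact (residue_eq_zero_iff _).1 (h1 i)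

lemma IsMinimalCover.bettiNumber_zero_eq_zero_iff [Module.Free R F] [Module.Finite R F] {φ : F →ₗ[R] M}
    (hφ : IsMinimalCover φ) : bettiNumber R M 0 = 0 ↔ Subsingleton M := by
  rw [hφ.bettiNumber_zero, Module.finrank_eq_zero_iff_of_free]
  refine ⟨fun _ => hφ.surjective.subsingleton, fun _ => ?_⟩
  have htop : (⊤ : Submodule R F) ≤ maximalIdeal R • ⊤ :=
    le_trans (fun x _ => Subsingleton.elim _ _) hφ.ker_le
  exact (Submodule.subsingleton_iff R).1 (subsingleton_of_bot_eq_top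
    (Submodule.eq_bot_of_le_smul_of_le_jacobson_bot _ _ Module.Finite.fg_top htop
      (maximalIdeal_le_jacobson _)).symm)

lemma bettiNumber_zero_eq_zero_iff [Module.Finite R M] :
    bettiNumber R M 0 = 0 ↔ Subsingleton M := by
  obtain ⟨n, φ, hφ⟩ := exists_isMinimalCover R M
  exact hφ.bettiNumber_zero_eq_zero_iff

/-- The projective dimension of a finitely generated module over a Noetherian local ring is
detected by the vanishing of Betti numbers. -/
theorem hasProjectiveDimensionLT_iff_bettiNumber_eq_zero [IsNoetherianRing R] (n : ℕ)
    (M : Type u) [AddCommGroup M] [Module R M] [Module.Finite R M] :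
    HasProjectiveDimensionLT (ModuleCat.of R M) n ↔ bettiNumber R M n = 0 := by
  induction n generalizing M with
  | zero =>
    rw [hasProjectiveDimensionLT_zero_iff_isZero, ModuleCat.isZero_iff_subsingleton]
    exact bettiNumber_zero_eq_zero_iff.symm
  | succ n ih =>
    obtain ⟨r, φ, hφ⟩ := exists_isMinimalCover R M
    have hS := LinearMap.shortExact_shortComplexKer hφ.surjective
    have hP : Projective φ.shortComplexKer.X₂ :=
      inferInstanceAs (Projective (ModuleCat.of R (Fin r → R)))
    rw [hφ.bettiNumber_succ, ← ih]
    cases n with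
    | zero =>
      refine ⟨fun h => ?_, fun h => hS.hasProjectiveDimensionLT_X₃ 0 h inferInstance⟩
      have : Projective (ModuleCat.of R M) := projective_iff_hasProjectiveDimensionLT_one.2 h
      have : Module.Projective R M := (IsProjective.iff_projective _).2 this
      obtain ⟨s, hs⟩ := Module.projective_lifting_property φ LinearMap.id hφ.surjective
      rw [hasProjectiveDimensionLT_zero_iff_isZero, ModuleCat.isZero_iff_subsingleton]
      -- `F = range s + ker φ` with `ker φ ≤ 𝔪F`, so the section `s` is onto by Nakayama and `φ` is
      -- injective.
      have hcompl : (LinearMap.range s) = ⊤ := by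
        rw [eq_top_iff]
        refine Submodule.le_of_le_smul_of_le_jacobson_bot (I := maximalIdeal R)
          Module.Finite.fg_top (maximalIdeal_le_jacobson _) fun x _ => ?_
        refine Submodule.mem_sup.2 ⟨s (φ x), ⟨_, rfl⟩, x - s (φ x), hφ.ker_le ?_, by abel⟩
        rw [LinearMap.mem_ker, map_sub, ← LinearMap.comp_apply φ s, hs, LinearMap.id_apply,
          sub_self]
      refine ⟨fun x y => Subtype.ext ?_⟩
      have key (z : LinearMap.ker φ) : (z : Fin r → R) = 0 := by
        obtain ⟨m, hm⟩ : (z : Fin r → R) ∈ LinearMap.range s := hcompl ▸ trivial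
        have := LinearMap.congr_fun hs m
        rw [LinearMap.comp_apply, hm, LinearMap.mem_ker.1 z.2, LinearMap.id_apply] at this
        rw [← hm, ← this, map_zero]
      rw [key x, key y]
    | succ n => exact hS.hasProjectiveDimensionLT_X₃_iff n hP

end MinimalCover

/-! ### Betti numbers of close submodules -/

section Perturbation

variable {R : Type u} [CommRing R] [IsLocalRing R] [IsNoetherianRing R]
  {F : Type u} [AddCommGroup F] [Module R F]

/-- A minimal cover of `L` can be perturbed to a minimal cover of any sufficiently close `L'`,
with close kernels. -/
lemma IsMinimalCover.exists_perturbation {E : Type u} [AddCommGroup E] [Module R E]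
    [Module.Finite R E] [Module.Free R F] {L : Submodule R E} {φ : F →ₗ[R] L}
    (hφ : IsMinimalCover φ) (c : ℕ) :
    ∃ c', ∀ L' : Submodule R E, AdicClose (maximalIdeal R) c' L L' →
      AdicClose (maximalIdeal R) c' L' L →
      ∃ ψ : F →ₗ[R] L', IsMinimalCover ψ ∧
        AdicClose (maximalIdeal R) c (LinearMap.ker φ) (LinearMap.ker ψ) ∧
        AdicClose (maximalIdeal R) c (LinearMap.ker ψ) (LinearMap.ker φ) := by
  have hr : LinearMap.range (L.subtype ∘ₗ φ) = L := by
    rw [LinearMap.range_comp, LinearMap.range_eq_top.2 hφ.surjective, Submodule.map_top,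
      Submodule.range_subtype]
  have hker : LinearMap.ker (L.subtype ∘ₗ φ) = LinearMap.ker φ :=
    LinearMap.ker_comp_of_ker_eq_bot _ (Submodule.ker_subtype L)
  obtain ⟨d, hd⟩ := exists_isArtinReesBound (maximalIdeal R) L
  refine ⟨c + d + 1, fun L' h h' => ?_⟩
  obtain ⟨ψ, rfl, h₁, h₂⟩ := BettiPerturbation.exists_perturbation (L.subtype ∘ₗ φ) (hr.symm ▸ hd)
    (hr.symm ▸ h) (hr.symm ▸ h')
  rw [hker] at h₁ h₂
  refine ⟨ψ.rangeRestrict, ⟨ψ.surjective_rangeRestrict, ?_⟩, ?_, ?_⟩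
  · rw [LinearMap.ker_rangeRestrict]
    refine h₂.le.trans (sup_le hφ.ker_le ?_)
    exact (pow_smul_top_anti (m := 1) (by omega)).trans (by rw [pow_one])
  · rw [LinearMap.ker_rangeRestrict]
    exact h₁.mono (by omega)
  · rw [LinearMap.ker_rangeRestrict]
    exact h₂.mono (by omega)

/-- Sufficiently close submodules have the same Betti numbers in a bounded range. -/
theorem exists_adicClose_imp_bettiNumber_eq (p : ℕ) (E : Type u) [AddCommGroup E] [Module R E]
    [Module.Finite R E] (L : Submodule R E) :
    ∃ c, ∀ L' : Submodule R E, AdicClose (maximalIdeal R) c L L' →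
      AdicClose (maximalIdeal R) c L' L →
      ∀ i ≤ p, bettiNumber R L i = bettiNumber R L' i := by
  induction p generalizing E L with
  | zero =>
    obtain ⟨n, φ, hφ⟩ := exists_isMinimalCover R L
    obtain ⟨c, hc⟩ := hφ.exists_perturbation 0
    refine ⟨c, fun L' h h' i hi => ?_⟩
    obtain ⟨ψ, hψ, -, -⟩ := hc L' h h'
    rw [Nat.le_zero.1 hi, hφ.bettiNumber_zero, hψ.bettiNumber_zero]
  | succ p ih =>
    obtain ⟨n, φ, hφ⟩ := exists_isMinimalCover R L
    -- The syzygy lives in a new ambient module, hence the induction over all `E`; `c₀` depends only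
    -- on `φ`, not on `L'`.
    obtain ⟨c₀, hc₀⟩ := ih (Fin n → R) (LinearMap.ker φ)
    obtain ⟨c, hc⟩ := hφ.exists_perturbation c₀
    refine ⟨c, fun L' h h' i hi => ?_⟩
    obtain ⟨ψ, hψ, h₁, h₂⟩ := hc L' h h'
    cases i with
    | zero => rw [hφ.bettiNumber_zero, hψ.bettiNumber_zero]
    | succ i =>
      rw [hφ.bettiNumber_succ, hψ.bettiNumber_succ]
      exact hc₀ _ h₁ h₂ i (by omega)

end Perturbation

/-! ### Hilbert functions and initial forms -/

section HilbertFunction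

variable {R : Type u} [CommRing R] [IsLocalRing R]

instance (M : Type u) [AddCommGroup M] [Module R M] (n : ℕ) :
    IsScalarTower R (ResidueField R) (GradedPiece R M n) :=
  inferInstanceAs (IsScalarTower R (R ⧸ maximalIdeal R) (GradedPiece R M n))

/-- The degree `n` component of `gr(R/I)` as a quotient of `𝔪ⁿ`. -/
def toGradedPiece (I : Ideal R) (n : ℕ) :
    (maximalIdeal R ^ n • ⊤ : Submodule R R) →ₗ[R] GradedPiece R (R ⧸ I) n :=
  Submodule.mkQ _ ∘ₗ I.mkQ.restrict (p := maximalIdeal R ^ n • ⊤)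
    (q := maximalIdeal R ^ n • ⊤) fun x hx => by
      have := Submodule.mem_map_of_mem (f := I.mkQ) hx
      rwa [Submodule.map_smul'', Submodule.map_top, Submodule.range_mkQ] at this

lemma toGradedPiece_surjective (I : Ideal R) (n : ℕ) :
    Function.Surjective (toGradedPiece I n) := by
  refine (Submodule.mkQ_surjective _).comp ?_
  rintro ⟨y, hy⟩
  have hy' : y ∈ (maximalIdeal R ^ n • ⊤ : Submodule R R).map I.mkQ := by
    rwa [Submodule.map_smul'', Submodule.map_top, Submodule.range_mkQ]
  obtain ⟨x, hx, rfl⟩ := hy'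
  exact ⟨⟨x, hx⟩, rfl⟩

lemma toGradedPiece_eq_zero_iff (I : Ideal R) (n : ℕ)
    (x : (maximalIdeal R ^ n • ⊤ : Submodule R R)) :
    toGradedPiece I n x = 0 ↔ (x : R) ∈ I ⊔ maximalIdeal R ^ (n + 1) • ⊤ := by
  have h1 : (maximalIdeal R ^ (n + 1) • ⊤ : Submodule R R).map I.mkQ =
      (maximalIdeal R • ⊤ : Submodule R (maximalIdeal R ^ n • ⊤ : Submodule R (R ⧸ I))).map
        (Submodule.subtype _) := by
    rw [Submodule.map_smul'', Submodule.map_smul'', Submodule.map_top, Submodule.map_top,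
      Submodule.range_mkQ, Submodule.range_subtype, pow_succ', Submodule.mul_smul]
  have h2 : (I ⊔ maximalIdeal R ^ (n + 1) • ⊤ : Submodule R R) =
      ((maximalIdeal R ^ (n + 1) • ⊤ : Submodule R R).map I.mkQ).comap I.mkQ := by
    rw [Submodule.comap_map_mkQ]
  rw [h2, h1, Submodule.mem_comap]
  refine (Submodule.Quotient.mk_eq_zero _).trans ?_
  exact (Submodule.injective_subtype _).mem_set_image.symm

/-- For ideals with the same Hilbert function, an inclusion of initial ideals is an equality. -/
theorem AdicClose.symm_of_hilbertFunction_eq [IsNoetherianRing R] {I J : Ideal R}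
    (h : AdicClose (maximalIdeal R) 1 I J) (hIJ : hilbertFunction J = hilbertFunction I) :
    AdicClose (maximalIdeal R) 1 J I := by
  intro n
  have hker : LinearMap.ker (toGradedPiece I n) ≤ LinearMap.ker (toGradedPiece J n) := by
    intro x hx
    rw [LinearMap.mem_ker, toGradedPiece_eq_zero_iff] at hx ⊢
    obtain ⟨y, hy, z, hz, hyz⟩ := Submodule.mem_sup.1 hx
    rw [← hyz]
    refine add_mem (h n ⟨hy, ?_⟩) (Submodule.mem_sup_right hz)
    rw [eq_sub_of_add_eq hyz]
    exact sub_mem x.2 (pow_smul_top_anti n.le_succ hz)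
  let g : GradedPiece R (R ⧸ I) n →ₗ[R] GradedPiece R (R ⧸ J) n :=
    (LinearMap.ker (toGradedPiece I n)).liftQ (toGradedPiece J n) hker ∘ₗ
      ((toGradedPiece I n).quotKerEquivOfSurjective (toGradedPiece_surjective I n)).symm
  have hg (x) : g (toGradedPiece I n x) = toGradedPiece J n x := by
    have : ((toGradedPiece I n).quotKerEquivOfSurjective (toGradedPiece_surjective I n)).symm
        (toGradedPiece I n x) = Submodule.Quotient.mk x := by
      rw [LinearEquiv.symm_apply_eq]
      rfl
    simp only [g, LinearMap.comp_apply, LinearEquiv.coe_coe, this]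
    rfl
  have hgs : Function.Surjective g := fun y => by
    obtain ⟨x, rfl⟩ := toGradedPiece_surjective J n y
    exact ⟨_, hg x⟩
  let g' := g.extendScalarsOfSurjective (residue_surjective (R := R))
  have : Module.Finite (ResidueField R) (GradedPiece R (R ⧸ I) n) :=
    Module.Finite.of_restrictScalars_finite R _ _
  have : Module.Finite (ResidueField R) (GradedPiece R (R ⧸ J) n) :=
    Module.Finite.of_restrictScalars_finite R _ _
  have hgi : Function.Injective g :=
    (LinearMap.injective_iff_surjective_of_finrank_eq_finrank (f := g')
      (congrFun hIJ n).symm).2 hgs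
  rintro x ⟨hx, hxn⟩
  have hxJ : toGradedPiece J n ⟨x, hxn⟩ = 0 :=
    (toGradedPiece_eq_zero_iff _ _ _).2 (Submodule.mem_sup_left hx)
  rw [← hg] at hxJ
  exact (toGradedPiece_eq_zero_iff I n ⟨x, hxn⟩).1 (hgi (hxJ.trans (map_zero g).symm))

/-- If `J` is close to `I` and has the same Hilbert function, then so is `I` to `J`, with a
uniform gain. -/
theorem exists_adicClose_of_congrModPow [IsNoetherianRing R] (I : Ideal R) (c : ℕ) :
    ∃ N, 0 < N ∧ ∀ J : Ideal R, CongrModPow J I N → hilbertFunction J = hilbertFunction I →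
      AdicClose (maximalIdeal R) c I J ∧ AdicClose (maximalIdeal R) c J I := by
  obtain ⟨d, hd⟩ := exists_isArtinReesBound (maximalIdeal R) (L := (I : Submodule R R))
  -- After the loss of `d`, a gain of `c + 1 ≥ 1` remains, enough to compare initial forms; `N ≥ d +
  -- 1` is what `transfer` needs.
  refine ⟨c + d + 1, by omega, fun J hJ hHF => ?_⟩
  have hpow (k : ℕ) : (maximalIdeal R ^ k • ⊤ : Submodule R R) = maximalIdeal R ^ k := by
    rw [smul_eq_mul, Ideal.mul_top]
  have hIJ : I ≤ J ⊔ maximalIdeal R ^ (c + d + 1) • ⊤ := by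
    rw [hpow, hJ]
    exact le_sup_left
  have hJI : J ≤ I ⊔ maximalIdeal R ^ (c + d + 1) • ⊤ := by
    rw [hpow, ← hJ]
    exact le_sup_left
  have h₁ := hd.adicClose (by omega) hIJ
  have hdJ := hd.transfer (hIJ.trans (sup_le_sup_left (pow_smul_top_anti (by omega)) _))
    ((h₁.mono (by omega)).symm_of_hilbertFunction_eq hHF)
  exact ⟨h₁.mono (by omega), (hdJ.adicClose (by omega) hJI).mono (by omega)⟩

lemma isMinimalCover_mkQ {I : Ideal R} (hI : I ≤ maximalIdeal R) : IsMinimalCover I.mkQ :=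
  ⟨I.mkQ_surjective, by rwa [Submodule.ker_mkQ, smul_eq_mul, Ideal.mul_top]⟩

/-- Sufficiently close ideals with the same Hilbert function have the same Betti numbers in a
bounded range. -/
theorem exists_congrModPow_imp_bettiNumber_eq [IsNoetherianRing R] (I : Ideal R) (p : ℕ) :
    ∃ N, 0 < N ∧ ∀ J : Ideal R, CongrModPow J I N → hilbertFunction J = hilbertFunction I →
      ∀ i ≤ p, bettiNumber R (R ⧸ I) i = bettiNumber R (R ⧸ J) i := by
  -- The unit ideal is separate: `R → R/I` is a minimal cover only for `I ≤ 𝔪`.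
  rcases eq_or_ne I ⊤ with rfl | hI
  · refine ⟨1, one_pos, fun J hJ _ i _ => ?_⟩
    have : J = ⊤ := by
      by_contra hJ'
      rw [CongrModPow, pow_one, top_sup_eq, sup_of_le_right (le_maximalIdeal hJ')] at hJ
      exact (maximalIdeal.isMaximal R).ne_top hJ
    rw [this]
  · obtain ⟨c, hc⟩ := exists_adicClose_imp_bettiNumber_eq p R I
    obtain ⟨N, hN, h⟩ := exists_adicClose_of_congrModPow I c
    refine ⟨N, hN, fun J hJ hHF i hi => ?_⟩
    have hI' := le_maximalIdeal hI
    have hJ' : J ≤ maximalIdeal R := by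
      refine (le_sup_left.trans hJ.le).trans (sup_le hI' ?_)
      exact Ideal.pow_le_self hN.ne'
    obtain ⟨h₁, h₂⟩ := h J hJ hHF
    have hmI := isMinimalCover_mkQ hI'
    have hmJ := isMinimalCover_mkQ hJ'
    cases i with
    | zero => rw [hmI.bettiNumber_zero, hmJ.bettiNumber_zero]
    | succ i =>
      rw [hmI.bettiNumber_succ, hmJ.bettiNumber_succ, Submodule.ker_mkQ, Submodule.ker_mkQ]
      exact hc J h₁ h₂ i (by omega)

end HilbertFunction

/-! ### Bounding finite projective dimensions by regular sequences -/

section FinitisticDimension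

open RingTheory.Sequence

variable {R : Type u} [CommRing R]
  {F M : Type u} [AddCommGroup F] [Module R F] [AddCommGroup M] [Module R M]

/-- Maximal regular sequences in a Noetherian local ring: one can find a regular sequence in `𝔪`
such that some element is annihilated by `𝔪` modulo the sequence. -/
theorem exists_isWeaklyRegular_socle (R : Type u) [CommRing R] [IsLocalRing R]
    [IsNoetherianRing R] :
    ∃ rs : List R, IsWeaklyRegular R rs ∧
      ∃ s ∉ Ideal.ofList rs, ∀ r ∈ maximalIdeal R, r * s ∈ Ideal.ofList rs := by
  obtain ⟨_, ⟨rs, hrm, hrs, rfl⟩, hmax⟩ := set_has_maximal_iff_noetherian.2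
    (inferInstance : IsNoetherian R R)
    {I | ∃ rs : List R, (∀ r ∈ rs, r ∈ maximalIdeal R) ∧ IsWeaklyRegular R rs ∧
      Ideal.ofList rs = I} ⟨_, [], by simp, IsWeaklyRegular.nil R R, rfl⟩
  refine ⟨rs, hrs, ?_⟩
  have hle : Ideal.ofList rs ≤ maximalIdeal R := Ideal.span_le.2 hrm
  have hne : Ideal.ofList rs ≠ ⊤ := fun h =>
    (maximalIdeal.isMaximal R).ne_top (top_le_iff.1 (h ▸ hle))
  have hsmul : (Ideal.ofList rs • ⊤ : Submodule R R) = Ideal.ofList rs := by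
    rw [smul_eq_mul, Ideal.mul_top]
  have hzero (x : R) (hx : x ∈ maximalIdeal R) :
      ¬ IsSMulRegular (R ⧸ (Ideal.ofList rs • ⊤ : Submodule R R)) x := by
    intro hreg
    refine hmax (Ideal.ofList (rs ++ [x])) ⟨rs ++ [x], ?_, ?_, rfl⟩ ?_
    · intro r hr
      rcases List.mem_append.1 hr with h | h
      · exact hrm r h
      · rwa [List.mem_singleton.1 h]
    · rw [isWeaklyRegular_append_iff]
      exact ⟨hrs, (isWeaklyRegular_singleton_iff _ _).2 hreg⟩
    · rw [Ideal.ofList_append, Ideal.ofList_singleton]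
      refine lt_of_le_of_ne le_sup_left fun h => hne ?_
      have hx' : x ∈ Ideal.ofList rs := h ▸ Ideal.mem_sup_right (Ideal.mem_span_singleton_self x)
      have : (Submodule.Quotient.mk 1 : R ⧸ (Ideal.ofList rs • ⊤ : Submodule R R)) = 0 := by
        apply hreg
        change x • _ = x • _
        rw [smul_zero, ← Submodule.Quotient.mk_smul, Submodule.Quotient.mk_eq_zero, hsmul,
          smul_eq_mul, mul_one]
        exact hx'
      rw [Submodule.Quotient.mk_eq_zero, hsmul] at this
      exact (Ideal.eq_top_iff_one _).2 this
  -- By maximality no element of `𝔪` is regular on `R/(rs)`, so `k` maps nontrivially to it; `s`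
  -- will lift the image of `1`.
  have hHom : ¬ Subsingleton (ResidueField R →ₗ[R]
      R ⧸ (Ideal.ofList rs • ⊤ : Submodule R R)) := by
    rw [IsSMulRegular.subsingleton_linearMap_iff]
    rintro ⟨x, hx, hreg⟩
    refine hzero x ?_ hreg
    rw [Module.mem_annihilator] at hx
    have := hx 1
    rw [Algebra.smul_def, mul_one] at this
    exact (residue_eq_zero_iff _).1 this
  rw [not_subsingleton_iff_nontrivial] at hHom
  obtain ⟨f, hf⟩ := exists_ne (0 : ResidueField R →ₗ[R]
      R ⧸ (Ideal.ofList rs • ⊤ : Submodule R R))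
  obtain ⟨s, hs⟩ := Submodule.Quotient.mk_surjective _ (f 1)
  refine ⟨s, fun hs' => hf ?_, fun r hr => ?_⟩
  · rw [← hsmul, ← Submodule.Quotient.mk_eq_zero, hs] at hs'
    ext x
    obtain ⟨a, rfl⟩ := residue_surjective x
    have : residue R a = a • (1 : ResidueField R) := by
      rw [Algebra.smul_def, mul_one]
      rfl
    rw [this, map_smul, hs', smul_zero, LinearMap.zero_apply]
  · have h0 : r • (1 : ResidueField R) = 0 := by
      rw [Algebra.smul_def, ResidueField.algebraMap_eq, (residue_eq_zero_iff _).2 hr, zero_mul]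
    rw [← hsmul, ← Submodule.Quotient.mk_eq_zero, ← smul_eq_mul, Submodule.Quotient.mk_smul, hs,
      ← map_smul, h0, map_zero]

lemma isWeaklyRegular_of_free [Module.Free R F] [Module.Finite R F] {rs : List R}
    (h : IsWeaklyRegular R rs) :
    IsWeaklyRegular F rs :=
  ((TensorProduct.rid R F).isWeaklyRegular_congr rs).1 (h.isWeaklyRegular_lTensor (M₂ := F))

/-- If `rs` is regular on `M`, then the inclusion of the kernel of `F → M` stays injective modulo
`rs`. -/
lemma mem_ofList_smul_top_of_coe_mem {rs : List R} {φ : F →ₗ[R] M} (hφ : Function.Surjective φ)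
    (hM : IsWeaklyRegular M rs) {x : LinearMap.ker φ}
    (hx : (x : F) ∈ (Ideal.ofList rs • ⊤ : Submodule R F)) :
    x ∈ (Ideal.ofList rs • ⊤ : Submodule R (LinearMap.ker φ)) := by
  have := map_first_exact_on_four_term_right_exact_of_isSMulRegular_last
    (f₁ := (0 : PUnit.{u + 1} →ₗ[R] LinearMap.ker φ)) (f₂ := (LinearMap.ker φ).subtype) (f₃ := φ)
    (fun y => by simp [eq_comm]) (LinearMap.exact_subtype_ker_map φ) hφ hM
  have h0 := (this (Submodule.Quotient.mk x)).1
    ((Submodule.Quotient.mk_eq_zero _).2 hx)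
  obtain ⟨y, hy⟩ := h0
  obtain ⟨y, rfl⟩ := Submodule.Quotient.mk_surjective _ y
  exact (Submodule.Quotient.mk_eq_zero _).1 hy.symm

/-- `ker φ / (rs)` embeds in `F / (rs)`, where `r` is regular. Only `rs` must be regular on `M`, so
a syzygy gains one element. -/
lemma isWeaklyRegular_ker_append {rs : List R} {r : R} {φ : F →ₗ[R] M}
    (hφ : Function.Surjective φ) (hM : IsWeaklyRegular M rs)
    (hF : IsWeaklyRegular F (rs ++ [r])) (hK : IsWeaklyRegular (LinearMap.ker φ) rs) :
    IsWeaklyRegular (LinearMap.ker φ) (rs ++ [r]) := by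
  rw [isWeaklyRegular_append_iff, isWeaklyRegular_singleton_iff] at hF ⊢
  refine ⟨hK, (isSMulRegular_iff_right_eq_zero_of_smul).2 fun x hx => ?_⟩
  obtain ⟨x, rfl⟩ := Submodule.Quotient.mk_surjective _ x
  rw [← Submodule.Quotient.mk_smul, Submodule.Quotient.mk_eq_zero] at hx
  refine (Submodule.Quotient.mk_eq_zero _).2 (mem_ofList_smul_top_of_coe_mem hφ hM ?_)
  have hx' := Submodule.mem_map_of_mem (f := (LinearMap.ker φ).subtype) hx
  rw [Submodule.map_smul''] at hx'
  have hx'' := SetLike.le_def.1 (smul_mono_right (Ideal.ofList rs) le_top) hx'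
  rw [← Submodule.Quotient.mk_eq_zero]
  refine (isSMulRegular_iff_right_eq_zero_of_smul).1 hF.2 _ ?_
  rw [← Submodule.Quotient.mk_smul, Submodule.Quotient.mk_eq_zero]
  exact hx''

lemma isWeaklyRegular_ker {rs : List R} {φ : F →ₗ[R] M}
    (hφ : Function.Surjective φ) (hM : IsWeaklyRegular M rs) (hF : IsWeaklyRegular F rs) :
    IsWeaklyRegular (LinearMap.ker φ) rs := by
  induction rs using List.reverseRecOn with
  | nil => exact IsWeaklyRegular.nil _ _
  | append_singleton rs r ih =>
    have hM' := ((isWeaklyRegular_append_iff _ _ _).1 hM).1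
    exact isWeaklyRegular_ker_append hφ hM' hF
      (ih hM' ((isWeaklyRegular_append_iff _ _ _).1 hF).1)

variable [IsLocalRing R] [IsNoetherianRing R]

/-- A module of finite projective dimension on which a maximal regular sequence is regular is
projective. -/
theorem hasProjectiveDimensionLT_one_of_isWeaklyRegular {rs : List R} (hrs : IsWeaklyRegular R rs)
    {s : R} (hs : s ∉ Ideal.ofList rs) (hsm : ∀ r ∈ maximalIdeal R, r * s ∈ Ideal.ofList rs)
    (n : ℕ) (M : Type u) [AddCommGroup M] [Module R M] [Module.Finite R M]
    (hM : IsWeaklyRegular M rs) (hn : HasProjectiveDimensionLT (ModuleCat.of R M) n) :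
    HasProjectiveDimensionLT (ModuleCat.of R M) 1 := by
  induction n generalizing M with
  | zero => exact hasProjectiveDimensionLT_of_ge _ 0 1 (by omega)
  | succ n ih =>
    cases n with
    | zero => exact hn
    | succ n =>
      obtain ⟨r, φ, hφ⟩ := exists_isMinimalCover R M
      have hS := LinearMap.shortExact_shortComplexKer hφ.surjective
      have hP : Projective φ.shortComplexKer.X₂ :=
        inferInstanceAs (Projective (ModuleCat.of R (Fin r → R)))
      have hK := ih (LinearMap.ker φ)
        (isWeaklyRegular_ker hφ.surjective hM (isWeaklyRegular_of_free hrs))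
        ((hS.hasProjectiveDimensionLT_X₃_iff n hP).1 hn)
      have hproj : Projective (ModuleCat.of R (LinearMap.ker φ)) :=
        projective_iff_hasProjectiveDimensionLT_one.2 hK
      have : Module.Projective R (LinearMap.ker φ) := (IsProjective.iff_projective _).2 hproj
      have : Module.Free R (LinearMap.ker φ) := Module.free_of_flat_of_isLocalRing
      -- A basis vector `b i` of the syzygy lies in `𝔪F`, so `s • b i` lies in `(rs)F`, hence in
      -- `(rs) ker φ`; its coordinate `s` would be in `(rs)`.
      have hsub : Subsingleton (LinearMap.ker φ) := by
        by_contra hne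
        rw [not_subsingleton_iff_nontrivial] at hne
        let b := Module.Free.chooseBasis R (LinearMap.ker φ)
        obtain ⟨i⟩ := b.index_nonempty
        refine hs ?_
        have hmem : s • b i ∈ (Ideal.ofList rs • ⊤ : Submodule R (LinearMap.ker φ)) := by
          refine mem_ofList_smul_top_of_coe_mem hφ.surjective hM ?_
          refine Submodule.smul_induction_on
            (p := fun x => s • x ∈ (Ideal.ofList rs • ⊤ : Submodule R (Fin r → R)))
            (hφ.ker_le (b i).2) ?_ ?_
          · intro a ha x _
            rw [smul_smul, mul_comm]
            exact Submodule.smul_mem_smul (hsm a ha) trivial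
          · intro x y hx hy
            rw [smul_add]
            exact add_mem hx hy
        have hcoord : b.coord i (s • b i) ∈ Ideal.ofList rs := by
          refine Submodule.smul_induction_on (p := fun x => b.coord i x ∈ Ideal.ofList rs)
            hmem ?_ ?_
          · intro a ha x _
            rw [map_smul, smul_eq_mul]
            exact Ideal.mul_mem_right _ _ ha
          · intro x y hx hy
            rw [map_add]
            exact add_mem hx hy
        rwa [map_smul, b.coord_apply, b.repr_self, Finsupp.single_eq_same, smul_eq_mul,
          mul_one] at hcoord
      have hK0 : HasProjectiveDimensionLT (ModuleCat.of R (LinearMap.ker φ)) 0 := by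
        rw [hasProjectiveDimensionLT_zero_iff_isZero, ModuleCat.isZero_iff_subsingleton]
        exact hsub
      exact hS.hasProjectiveDimensionLT_X₃ 0 hK0 inferInstance

/-- Each syzygy moves one element from `l₂` to `l₁`; once `l₂` is exhausted, the syzygy is
projective. -/
theorem hasProjectiveDimensionLT_length_add_one {l₁ l₂ : List R}
    (hrs : IsWeaklyRegular R (l₁ ++ l₂)) {s : R} (hs : s ∉ Ideal.ofList (l₁ ++ l₂))
    (hsm : ∀ r ∈ maximalIdeal R, r * s ∈ Ideal.ofList (l₁ ++ l₂))
    (n : ℕ) (M : Type u) [AddCommGroup M] [Module R M] [Module.Finite R M]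
    (hM : IsWeaklyRegular M l₁) (hn : HasProjectiveDimensionLT (ModuleCat.of R M) n) :
    HasProjectiveDimensionLT (ModuleCat.of R M) (l₂.length + 1) := by
  induction l₂ generalizing l₁ M n with
  | nil =>
    rw [List.append_nil] at hrs hs hsm
    exact hasProjectiveDimensionLT_one_of_isWeaklyRegular hrs hs hsm n M hM hn
  | cons r l₂ ih =>
    obtain ⟨k, φ, hφ⟩ := exists_isMinimalCover R M
    have hS := LinearMap.shortExact_shortComplexKer hφ.surjective
    have hP : Projective φ.shortComplexKer.X₂ :=
      inferInstanceAs (Projective (ModuleCat.of R (Fin k → R)))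
    rw [List.append_cons] at hrs hs hsm
    have hF : IsWeaklyRegular (Fin k → R) (l₁ ++ [r]) :=
      isWeaklyRegular_of_free ((isWeaklyRegular_append_iff _ _ _).1 hrs).1
    have hK := ih hrs hs hsm (n + 1) (LinearMap.ker φ)
      (isWeaklyRegular_ker_append hφ.surjective hM hF
      (isWeaklyRegular_ker hφ.surjective hM ((isWeaklyRegular_append_iff _ _ _).1 hF).1)) ?_
    · exact (hS.hasProjectiveDimensionLT_X₃_iff l₂.length hP).2 hK
    · exact (hS.hasProjectiveDimensionLT_X₃_iff n hP).1
        (hasProjectiveDimensionLT_of_ge _ n (n + 2) (by omega))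

/-- Over a Noetherian local ring, the finite projective dimensions of finitely generated modules
are bounded. -/
theorem exists_bound_projectiveDimension (R : Type u) [CommRing R] [IsLocalRing R]
    [IsNoetherianRing R] :
    ∃ b, ∀ (M : Type u) [AddCommGroup M] [Module R M] [Module.Finite R M] (n : ℕ),
      HasProjectiveDimensionLT (ModuleCat.of R M) n →
      HasProjectiveDimensionLT (ModuleCat.of R M) b := by
  obtain ⟨rs, hrs, s, hs, hsm⟩ := exists_isWeaklyRegular_socle R
  exact ⟨rs.length + 1, fun M _ _ _ n hn =>
    hasProjectiveDimensionLT_length_add_one (l₁ := []) hrs hs hsm n M (IsWeaklyRegular.nil _ _) hn⟩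

end FinitisticDimension

end BettiPerturbation

end

/-! ### Stability of Betti numbers and projective dimension -/

theorem mainTheorem2 {R : Type u} [CommRing R] [IsLocalRing R] [IsNoetherianRing R]
    (I : Ideal R) :
    (∀ p : ℕ, ∃ N : ℕ, 0 < N ∧ ∀ J : Ideal R,
      BettiPerturbation.CongrModPow J I N →
      BettiPerturbation.hilbertFunction J = BettiPerturbation.hilbertFunction I →
      ∀ i ≤ p, BettiPerturbation.bettiNumber R (R ⧸ I) i =
        BettiPerturbation.bettiNumber R (R ⧸ J) i) ∧
    (∃ N₀ : ℕ, ∀ N ≥ N₀, ∀ J : Ideal R,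
      BettiPerturbation.CongrModPow J I N →
      BettiPerturbation.hilbertFunction J = BettiPerturbation.hilbertFunction I →
      BettiPerturbation.projDimQuotient I = BettiPerturbation.projDimQuotient J) := by
  refine ⟨BettiPerturbation.exists_congrModPow_imp_bettiNumber_eq I, ?_⟩
  obtain ⟨b, hb⟩ := BettiPerturbation.exists_bound_projectiveDimension R
  obtain ⟨N₀, -, h⟩ := BettiPerturbation.exists_congrModPow_imp_bettiNumber_eq I b
  refine ⟨N₀, fun N hN J hJ hHF => ?_⟩
  have hJ' : BettiPerturbation.CongrModPow J I N₀ := by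
    have h1 : maximalIdeal R ^ N ⊔ maximalIdeal R ^ N₀ = maximalIdeal R ^ N₀ :=
      sup_of_le_right (Ideal.pow_le_pow_right hN)
    rw [BettiPerturbation.CongrModPow, ← h1, ← sup_assoc, hJ, sup_assoc]
  have key (n : ℕ) : HasProjectiveDimensionLT (ModuleCat.of R (R ⧸ I)) n ↔
      HasProjectiveDimensionLT (ModuleCat.of R (R ⧸ J)) n := by
    have small (m : ℕ) (hm : m ≤ b) : HasProjectiveDimensionLT (ModuleCat.of R (R ⧸ I)) m ↔
        HasProjectiveDimensionLT (ModuleCat.of R (R ⧸ J)) m := by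
      rw [BettiPerturbation.hasProjectiveDimensionLT_iff_bettiNumber_eq_zero,
        BettiPerturbation.hasProjectiveDimensionLT_iff_bettiNumber_eq_zero, h J hJ' hHF m hm]
    -- Beyond `b`, having projective dimension `< n` is the same as having it `< b`.
    rcases le_total n b with hn | hn
    · exact small n hn
    · constructor <;> intro hI
      · have := (small b le_rfl).1 (hb _ n hI)
        exact hasProjectiveDimensionLT_of_ge _ b n hn
      · have := (small b le_rfl).2 (hb _ n hI)
        exact hasProjectiveDimensionLT_of_ge _ b n hn
  rw [BettiPerturbation.projDimQuotient, BettiPerturbation.projDimQuotient, projectiveDimension,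
    projectiveDimension]
  simp only [key]
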